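/- Let $d\ge 1$, let $M_d(\mathbb{R})$ be the space of real $d\times d$ matrices with the Euclidean operator norm $\|\cdot\|$, and let $\mathcal{K}(GL_d(\mathbb{R}))$ be the set of all nonempty compact sets of invertible real $d\times d$ matrices, equipped with the Hausdorff metric \[ d_H(\mathsf{A},\mathsf{B})=\max\Big\{\sup_{A\in\mathsf{A}}\inf_{B\in\mathsf{B}}\|A-B\|,\ \sup_{B\in\mathsf{B}}\inf_{A\in\mathsf{A}}\|A-B\|\Big\}. \] For a nonempty set $\mathsf{A}\subset M_d(\mathbb{R})$ let \[ \check{\varrho}(\mathsf{A})=\inf_{n\ge 1}\ \inf\big\{\|A_n\cdots A_1\|^{1/n} : A_1,\dots,A_n\in\mathsf{A}\big\} \] be its lower spectral radius. If $\mathsf{A}=\{A\}\in\mathcal{K}(GL_d(\mathbb{R}))$ is a singleton, then the function $\check{\varrho}\colon\mathcal{K}(GL_d(\mathbb{R}))\to[0,\infty)$ is continuous at $\mathsf{A}$. -/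

import Mathlib

open scoped Matrix.Norms.L2Operator

/-- `𝒦(GL_d(ℝ))`: the nonempty compact sets of real `d × d` matrices all of whose elements are
invertible. -/
def CompactsGL (d : ℕ) : Type :=
  {K : TopologicalSpace.NonemptyCompacts (Matrix (Fin d) (Fin d) ℝ) //
    ∀ M ∈ K, IsUnit M}

namespace CompactsGL

/-- The underlying set of matrices. -/
def toSet {d : ℕ} (K : CompactsGL d) : Set (Matrix (Fin d) (Fin d) ℝ) :=
  (K.1 : Set (Matrix (Fin d) (Fin d) ℝ))

/-- `𝒦(GL_d(ℝ))` carries the Hausdorff metric induced by the Euclidean operator norm. -/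
noncomputable instance instMetricSpace (d : ℕ) : MetricSpace (CompactsGL d) :=
  inferInstanceAs (MetricSpace
    {K : TopologicalSpace.NonemptyCompacts (Matrix (Fin d) (Fin d) ℝ) // ∀ M ∈ K, IsUnit M})

theorem dist_eq {d : ℕ} (K L : CompactsGL d) :
    dist K L = Metric.hausdorffDist K.toSet L.toSet := rfl

end CompactsGL

/-- The lower spectral radius of a nonempty set `S` of real `d × d` matrices: the infimum over
`n ≥ 1` and over all products `A_n ⋯ A_1` of `n` elements of `S` of `‖A_n ⋯ A_1‖ ^ (1 / n)`,
for the Euclidean operator norm. The list `L` is `[A_n, …, A_1]`. -/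
noncomputable def lowerSpectralRadius {d : ℕ} (S : Set (Matrix (Fin d) (Fin d) ℝ)) : ℝ :=
  ⨅ n : ℕ+, sInf {r : ℝ | ∃ L : List (Matrix (Fin d) (Fin d) ℝ),
    L.length = (n : ℕ) ∧ (∀ B ∈ L, B ∈ S) ∧ r = ‖L.prod‖ ^ (1 / ((n : ℕ) : ℝ))}

/-! The limit value is `ρ`, the largest modulus of an eigenvalue of `M`. In suitable complex
coordinates `M` is as close as desired to a diagonal matrix, and so are all matrices near `M`. Upper
bound: there one such matrix `B` stretches the ℓ¹ norm by at most `ρ + d * η`, so its powers alone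
bound the lower spectral radius of any set containing it. Lower bound: every product must be
controlled. The cone of vectors dominated by their coordinates of maximal modulus is preserved by
all nearby matrices, each expanding it by nearly `ρ` (`cone_mulVec`), so mixed products cannot
cancel this growth. `exists_growth_rate` combines both bounds; constants from the change of
coordinates vanish under `k`-th roots. -/

lemma le_of_forall_mul_pow_le {c x y : ℝ} (hc : 0 < c) (hy : 0 ≤ y)
    (h : ∀ k : ℕ, 0 < k → c * x ^ k ≤ y ^ k) : x ≤ y := by
  by_contra! hlt
  have hx0 : 0 < x := hy.trans_lt hlt
  obtain ⟨k, hk⟩ := exists_pow_lt_of_lt_one hc ((div_lt_one hx0).2 hlt)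
  have h1 : (y / x) ^ (k + 1) < c :=
    (pow_le_pow_of_le_one (by positivity) ((div_lt_one hx0).2 hlt).le (Nat.le_succ k)).trans_lt hk
  rw [div_pow, div_lt_iff₀ (by positivity)] at h1
  exact (h (k + 1) k.succ_pos).not_gt h1

/-! ### Near-diagonalization over ℂ -/

open Module in
/-- Every endomorphism of a complex vector space is, in suitable bases, arbitrarily close to a
fixed diagonal matrix. -/
theorem exists_basis_near_diagonal (n : ℕ) (V : Type*) [AddCommGroup V] [Module ℂ V]
    [FiniteDimensional ℂ V] (hn : finrank ℂ V = n) (f : V →ₗ[ℂ] V) :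
    ∃ μ : Fin n → ℂ, ∀ η : ℝ, 0 < η → ∃ b : Basis (Fin n) ℂ V, ∃ c : Fin n → Fin n → ℂ,
      (∀ i j, ‖c i j‖ ≤ η) ∧ ∀ j, f (b j) = μ j • b j + ∑ i, c i j • b i := by
  induction n generalizing V with
  | zero =>
    exact ⟨Fin.elim0, fun η _ => ⟨finBasisOfFinrankEq ℂ V hn, fun i => i.elim0,
      fun i => i.elim0, fun j => j.elim0⟩⟩
  | succ n ih =>
    have : Nontrivial V := nontrivial_of_finrank_pos (R := ℂ) (by omega)
    obtain ⟨l, hl⟩ := End.exists_eigenvalue f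
    have hlt : LinearMap.range (f - l • LinearMap.id) < ⊤ := by
      rw [lt_top_iff_ne_top]
      intro h
      have hk := LinearMap.ker_eq_bot_iff_range_eq_top.2 h
      obtain ⟨v, hv⟩ := hl.exists_hasEigenvector
      refine hv.2 ((LinearMap.ker_eq_bot'.1 hk) v ?_)
      simp [hv.apply_eq_smul]
    -- The hyperplane `ker φ` contains the range of `f - l`, hence is `f`-invariant, and the
    -- induction runs on it.
    obtain ⟨φ, hφ, hle⟩ := Submodule.exists_le_ker_of_lt_top _ hlt
    have hrank : finrank ℂ (LinearMap.ker φ) = n := by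
      have := Dual.finrank_ker_add_one_of_ne_zero hφ
      omega
    have hmem (v : V) : f v - l • v ∈ LinearMap.ker φ := hle ⟨v, by simp⟩
    have hinv : ∀ v ∈ LinearMap.ker φ, f v ∈ LinearMap.ker φ := fun v hv => by
      have := add_mem (hmem v) (Submodule.smul_mem _ l hv)
      simpa using this
    obtain ⟨μ, hμ⟩ := ih (LinearMap.ker φ) hrank (f.restrict hinv)
    obtain ⟨w, hw⟩ : ∃ w, φ w ≠ 0 := by
      by_contra! h
      exact hφ (LinearMap.ext h)
    refine ⟨Fin.cons l μ, fun η hη => ?_⟩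
    obtain ⟨b, c, hc, hb⟩ := hμ η hη
    let h : LinearMap.ker φ := ⟨f w - l • w, hmem w⟩
    obtain ⟨R, hR⟩ : ∃ R, ∀ i, ‖b.repr h i‖ ≤ R :=
      ⟨∑ i, ‖b.repr h i‖, fun i =>
        Finset.single_le_sum (f := fun i => ‖b.repr h i‖) (fun _ _ => norm_nonneg _)
          (Finset.mem_univ i)⟩
    -- Scaling `w` by `t` scales its off-diagonal coefficients by `t` and leaves the eigenvalue `l`
    -- unchanged.
    let t : ℝ := η / (|R| + 1)
    have ht : 0 < t := by positivity
    have htw : φ ((t : ℂ) • w) ≠ 0 := by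
      simp [hw, ht.ne']
    let b' : Basis (Fin (n + 1)) ℂ V := Basis.mkFinCons ((t : ℂ) • w) b
      (fun a x hx h0 => by
        have := congrArg φ h0
        rw [map_add, map_smul, LinearMap.mem_ker.1 hx, add_zero, map_zero, smul_eq_mul] at this
        exact (mul_eq_zero.1 this).resolve_right htw)
      (fun z => ⟨-(φ z / φ ((t : ℂ) • w)), by
        rw [LinearMap.mem_ker, map_add, map_smul, smul_eq_mul]
        field_simp
        ring⟩)
    refine ⟨b', Fin.cons (fun _ => 0) (fun i => Fin.cons ((t : ℂ) * b.repr h i) (c i)), ?_, ?_⟩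
    · intro i j
      refine Fin.cases ?_ (fun i => ?_) i
      · simpa using hη.le
      · refine Fin.cases ?_ (fun j => ?_) j
        · simp only [Fin.cons_succ, Fin.cons_zero, norm_mul, Complex.norm_real, Real.norm_eq_abs,
            abs_of_pos ht]
          calc t * ‖b.repr h i‖ ≤ t * (|R| + 1) := by
                have := (hR i).trans (le_abs_self R)
                gcongr
                linarith
            _ = η := div_mul_cancel₀ _ (by positivity)
        · simpa using hc i j
    · intro j
      have hb0 : b' 0 = (t : ℂ) • w := by simp [b']
      have hbs (i : Fin n) : b' i.succ = (b i : V) := by simp [b']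
      refine Fin.cases ?_ (fun j => ?_) j
      · rw [Fin.sum_univ_succ]
        simp only [Fin.cons_succ, Fin.cons_zero, hb0, hbs, zero_smul, zero_add, map_smul]
        have h1 : (∑ i, b.repr h i • (b i : V)) = f w - l • w := by
          have := congrArg (LinearMap.ker φ).subtype (b.sum_repr h)
          rw [map_sum] at this
          exact this
        simp only [mul_smul, ← Finset.smul_sum, h1]
        module
      · rw [Fin.sum_univ_succ]
        simp only [Fin.cons_succ, Fin.cons_zero, hbs, zero_smul, zero_add]
        have := congrArg Subtype.val (hb j)
        simpa using this

/-! ### ℓ¹ growth and invariant cones near a diagonal matrix -/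

section NearDiagonal

variable {d : ℕ} {μ : Fin d → ℂ} {η ρ : ℝ} {T : Matrix (Fin d) (Fin d) ℂ}

lemma norm_mulVec_sub_le (hT : ∀ i j, ‖T i j - Matrix.diagonal μ i j‖ ≤ η) (x : Fin d → ℂ)
    (i : Fin d) : ‖(T.mulVec x) i - μ i * x i‖ ≤ η * ∑ j, ‖x j‖ := by
  have h : (T.mulVec x) i - μ i * x i = ∑ j, (T i j - Matrix.diagonal μ i j) * x j := by
    simp only [sub_mul, Finset.sum_sub_distrib]
    rw [← Matrix.mulVec_diagonal]
    rfl
  rw [h, Finset.mul_sum]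
  refine (norm_sum_le _ _).trans (Finset.sum_le_sum fun j _ => ?_)
  rw [norm_mul]
  exact mul_le_mul_of_nonneg_right (hT i j) (norm_nonneg _)

lemma sum_norm_mulVec_le (hT : ∀ i j, ‖T i j - Matrix.diagonal μ i j‖ ≤ η)
    (hρ : ∀ i, ‖μ i‖ ≤ ρ) (x : Fin d → ℂ) :
    ∑ i, ‖(T.mulVec x) i‖ ≤ (ρ + d * η) * ∑ i, ‖x i‖ := by
  have h (i : Fin d) : ‖(T.mulVec x) i‖ ≤ ρ * ‖x i‖ + η * ∑ j, ‖x j‖ := by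
    have h1 := norm_mulVec_sub_le hT x i
    have h2 := norm_sub_norm_le ((T.mulVec x) i) (μ i * x i)
    rw [norm_mul] at h2
    have h3 := mul_le_mul_of_nonneg_right (hρ i) (norm_nonneg (x i))
    linarith
  refine (Finset.sum_le_sum fun i _ => h i).trans_eq ?_
  rw [Finset.sum_add_distrib, ← Finset.mul_sum, Finset.sum_const, Finset.card_univ,
    Fintype.card_fin, nsmul_eq_mul]
  ring

lemma sum_norm_pow_mulVec_le (hT : ∀ i j, ‖T i j - Matrix.diagonal μ i j‖ ≤ η)
    (hρ : ∀ i, ‖μ i‖ ≤ ρ) (h0 : 0 ≤ ρ + d * η) (x : Fin d → ℂ) (n : ℕ) :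
    ∑ i, ‖((T ^ n).mulVec x) i‖ ≤ (ρ + d * η) ^ n * ∑ i, ‖x i‖ := by
  induction n with
  | zero => simp
  | succ n ih =>
    rw [pow_succ', ← Matrix.mulVec_mulVec]
    refine (sum_norm_mulVec_le hT hρ _).trans ?_
    rw [pow_succ', mul_assoc]
    exact mul_le_mul_of_nonneg_left ih h0

/-- The cone of vectors dominated by their coordinates in `s` is invariant under matrices close to
a diagonal matrix whose entries of largest modulus are those in `s`, and these expand it. -/
lemma cone_mulVec (hT : ∀ i j, ‖T i j - Matrix.diagonal μ i j‖ ≤ η) (s : Finset (Fin d))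
    (hη : 0 ≤ η) (hs : ∀ i ∈ s, ρ ≤ ‖μ i‖) (hsc : ∀ i ∈ sᶜ, ‖μ i‖ ≤ ρ - 4 * (d * η))
    (h0 : 0 ≤ ρ - 4 * (d * η)) {x : Fin d → ℂ} (hx : ∑ i ∈ sᶜ, ‖x i‖ ≤ ∑ i ∈ s, ‖x i‖) :
    (ρ - 2 * (d * η)) * ∑ i ∈ s, ‖x i‖ ≤ ∑ i ∈ s, ‖(T.mulVec x) i‖ ∧
    ∑ i ∈ sᶜ, ‖(T.mulVec x) i‖ ≤ ∑ i ∈ s, ‖(T.mulVec x) i‖ := by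
  set X := ∑ i ∈ s, ‖x i‖ with hX
  have hX0 : 0 ≤ X := Finset.sum_nonneg fun _ _ => norm_nonneg _
  -- On the cone the total perturbation is at most `2 * (d * η) * X`. The gap `4 * (d * η)` absorbs
  -- it twice: once as loss on `s`, once as gain on `sᶜ`.
  have htot : ∑ j, ‖x j‖ ≤ 2 * X := by
    rw [← Finset.sum_add_sum_compl s]
    linarith
  have hdev (i : Fin d) : ‖(T.mulVec x) i - μ i * x i‖ ≤ η * (2 * X) :=
    (norm_mulVec_sub_le hT x i).trans (mul_le_mul_of_nonneg_left htot hη)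
  have hcard (u : Finset (Fin d)) : (∑ _i ∈ u, η * (2 * X)) ≤ 2 * (d * η) * X := by
    rw [Finset.sum_const, nsmul_eq_mul]
    have : (u.card : ℝ) ≤ d := by exact_mod_cast card_finset_fin_le u
    nlinarith [mul_le_mul_of_nonneg_right this (mul_nonneg hη hX0)]
  have h1 : ρ * X ≤ ∑ i ∈ s, ‖(T.mulVec x) i‖ + ∑ _i ∈ s, η * (2 * X) := by
    rw [hX, Finset.mul_sum, ← Finset.sum_add_distrib, ← hX]
    refine Finset.sum_le_sum fun i hi => ?_
    have h2 := norm_sub_norm_le (μ i * x i) ((T.mulVec x) i)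
    rw [norm_sub_rev, norm_mul] at h2
    have h3 := mul_le_mul_of_nonneg_right (hs i hi) (norm_nonneg (x i))
    linarith [hdev i]
  have h2 : ∑ i ∈ sᶜ, ‖(T.mulVec x) i‖ ≤
      (ρ - 4 * (d * η)) * ∑ i ∈ sᶜ, ‖x i‖ + ∑ _i ∈ sᶜ, η * (2 * X) := by
    rw [Finset.mul_sum, ← Finset.sum_add_distrib]
    refine Finset.sum_le_sum fun i hi => ?_
    have h2 := norm_sub_norm_le ((T.mulVec x) i) (μ i * x i)
    rw [norm_mul] at h2
    have h3 := mul_le_mul_of_nonneg_right (hsc i hi) (norm_nonneg (x i))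
    linarith [hdev i]
  have h3 := mul_le_mul_of_nonneg_left hx h0
  have h4 := hcard s
  have h5 := hcard sᶜ
  constructor <;> linarith

lemma cone_list_prod_mulVec (s : Finset (Fin d))
    (hη : 0 ≤ η) (hs : ∀ i ∈ s, ρ ≤ ‖μ i‖) (hsc : ∀ i ∈ sᶜ, ‖μ i‖ ≤ ρ - 4 * (d * η))
    (h0 : 0 ≤ ρ - 4 * (d * η)) {x : Fin d → ℂ} (hx : ∑ i ∈ sᶜ, ‖x i‖ ≤ ∑ i ∈ s, ‖x i‖)
    (L : List (Matrix (Fin d) (Fin d) ℂ))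
    (hL : ∀ T ∈ L, ∀ i j, ‖T i j - Matrix.diagonal μ i j‖ ≤ η) :
    (ρ - 2 * (d * η)) ^ L.length * ∑ i ∈ s, ‖x i‖ ≤ ∑ i ∈ s, ‖(L.prod.mulVec x) i‖ ∧
    ∑ i ∈ sᶜ, ‖(L.prod.mulVec x) i‖ ≤ ∑ i ∈ s, ‖(L.prod.mulVec x) i‖ := by
  induction L with
  | nil => simpa using hx
  | cons T L ih =>
    obtain ⟨h1, h2⟩ := ih fun T hT => hL T (List.mem_cons_of_mem _ hT)
    obtain ⟨h3, h4⟩ := cone_mulVec (hL T List.mem_cons_self) s hη hs hsc h0 h2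
    rw [List.prod_cons, ← Matrix.mulVec_mulVec]
    refine ⟨le_trans ?_ h3, h4⟩
    rw [List.length_cons, pow_succ', mul_assoc]
    have : 0 ≤ (d : ℝ) * η := by positivity
    exact mul_le_mul_of_nonneg_left h1 (by linarith)

end NearDiagonal

/-! ### Transfer to real matrices -/

theorem exists_algHom_near_diagonal {d : ℕ} (M : Matrix (Fin d) (Fin d) ℝ) :
    ∃ μ : Fin d → ℂ, ∀ η : ℝ, 0 < η →
      ∃ Φ : Matrix (Fin d) (Fin d) ℝ →ₐ[ℝ] Matrix (Fin d) (Fin d) ℂ, Function.Injective Φ ∧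
        ∀ i j, ‖Φ M i j - Matrix.diagonal μ i j‖ ≤ η := by
  obtain ⟨μ, hμ⟩ := exists_basis_near_diagonal d (Fin d → ℂ) (by simp)
    (Matrix.toLin' (M.map (algebraMap ℝ ℂ)))
  refine ⟨μ, fun η hη => ?_⟩
  obtain ⟨b, c, hc, hb⟩ := hμ η hη
  let e : Matrix (Fin d) (Fin d) ℂ ≃ₐ[ℂ] Matrix (Fin d) (Fin d) ℂ :=
    Matrix.toLinAlgEquiv'.trans (LinearMap.toMatrixAlgEquiv b)
  refine ⟨(e.toAlgHom.restrictScalars ℝ).comp (Algebra.ofId ℝ ℂ).mapMatrix, ?_, fun i j => ?_⟩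
  · exact e.injective.comp (Matrix.map_injective (algebraMap ℝ ℂ).injective)
  · have h : e (M.map (algebraMap ℝ ℂ)) i j = Matrix.diagonal μ i j + c i j := by
      change LinearMap.toMatrixAlgEquiv b (Matrix.toLin' (M.map (algebraMap ℝ ℂ))) i j = _
      rw [LinearMap.toMatrixAlgEquiv_apply, hb]
      simp [Finsupp.single_apply, Matrix.diagonal_apply]
      grind
    change ‖e (M.map (algebraMap ℝ ℂ)) i j - _‖ ≤ η
    rw [h, add_sub_cancel_left]
    exact hc i j

lemma exists_norm_entry_le {d : ℕ}
    (Φ : Matrix (Fin d) (Fin d) ℝ →ₐ[ℝ] Matrix (Fin d) (Fin d) ℂ) :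
    ∃ C : ℝ, 0 < C ∧ ∀ B i j, ‖Φ B i j‖ ≤ C * ‖B‖ := by
  obtain ⟨C, hC, h⟩ := (LinearMap.toContinuousLinearMap
    ((LinearMap.pi fun i => LinearMap.pi fun j =>
      (Matrix.entryLinearMap ℝ ℂ i j).comp Φ.toLinearMap) :
        Matrix (Fin d) (Fin d) ℝ →ₗ[ℝ] (Fin d → Fin d → ℂ))).bound
  exact ⟨C, hC, fun B i j => ((norm_le_pi_norm _ j).trans (norm_le_pi_norm _ i)).trans (h B)⟩

lemma exists_norm_le_sum_norm_entry {d : ℕ}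
    {Φ : Matrix (Fin d) (Fin d) ℝ →ₐ[ℝ] Matrix (Fin d) (Fin d) ℂ} (hΦ : Function.Injective Φ) :
    ∃ C : ℝ, 0 < C ∧ ∀ B, ‖B‖ ≤ C * ∑ j, ∑ i, ‖Φ B i j‖ := by
  obtain ⟨K, hK, h⟩ := LinearMap.exists_antilipschitzWith
    ((LinearMap.pi fun i => LinearMap.pi fun j =>
      (Matrix.entryLinearMap ℝ ℂ i j).comp Φ.toLinearMap) :
        Matrix (Fin d) (Fin d) ℝ →ₗ[ℝ] (Fin d → Fin d → ℂ)) (by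
          rw [LinearMap.ker_eq_bot]
          intro B B' hB
          refine hΦ (Matrix.ext fun i j => ?_)
          exact congrFun (congrFun hB i) j)
  refine ⟨K, hK, fun B => ?_⟩
  have h1 := h.le_mul_dist B 0
  rw [dist_zero_right, map_zero, dist_zero_right] at h1
  refine h1.trans (mul_le_mul_of_nonneg_left ?_ K.2)
  have h0 : 0 ≤ ∑ j, ∑ i, ‖Φ B i j‖ := by positivity
  refine (pi_norm_le_iff_of_nonneg h0).2 fun i => (pi_norm_le_iff_of_nonneg h0).2 fun j => ?_
  exact (Finset.single_le_sum (f := fun i => ‖Φ B i j‖) (fun _ _ => norm_nonneg _)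
    (Finset.mem_univ i)).trans (Finset.single_le_sum (f := fun j => ∑ i, ‖Φ B i j‖)
      (fun _ _ => by positivity) (Finset.mem_univ j))

lemma exists_forall_norm_sub_lt_near_diagonal {d : ℕ} {M : Matrix (Fin d) (Fin d) ℝ}
    {Φ : Matrix (Fin d) (Fin d) ℝ →ₐ[ℝ] Matrix (Fin d) (Fin d) ℂ} {μ : Fin d → ℂ} {η : ℝ}
    (hη : 0 < η) (hM : ∀ i j, ‖Φ M i j - Matrix.diagonal μ i j‖ ≤ η / 2) :
    ∃ δ : ℝ, 0 < δ ∧ ∀ B, ‖B - M‖ < δ → ∀ i j, ‖Φ B i j - Matrix.diagonal μ i j‖ ≤ η := by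
  obtain ⟨C, hC, h⟩ := exists_norm_entry_le Φ
  refine ⟨η / 2 / C, by positivity, fun B hB i j => ?_⟩
  have h1 := h (B - M) i j
  rw [lt_div_iff₀ hC] at hB
  rw [map_sub, Matrix.sub_apply] at h1
  calc _ = ‖(Φ B i j - Φ M i j) + (Φ M i j - Matrix.diagonal μ i j)‖ := by ring_nf
    _ ≤ _ := norm_add_le _ _
    _ ≤ η := by linarith [hM i j]

open Filter Topology in
/-- The growth rate of the products of matrices depends continuously on the factors near a
constant sequence. -/
theorem exists_growth_rate {d : ℕ} [NeZero d] (M : Matrix (Fin d) (Fin d) ℝ) :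
    ∃ ρ : ℝ, 0 ≤ ρ ∧
      (∀ s, ρ < s → ∃ δ > 0, ∃ C > 0, ∀ B : Matrix (Fin d) (Fin d) ℝ, ‖B - M‖ < δ →
        ∀ n : ℕ, ‖B ^ n‖ ≤ C * s ^ n) ∧
      (∀ a, 0 < a → a < ρ → ∃ δ > 0, ∃ c > 0, ∀ L : List (Matrix (Fin d) (Fin d) ℝ),
        (∀ B ∈ L, ‖B - M‖ < δ) → c * a ^ L.length ≤ ‖L.prod‖) := by
  obtain ⟨μ, hμ⟩ := exists_algHom_near_diagonal M
  obtain ⟨i₀, hi₀⟩ := Finite.exists_max fun i => ‖μ i‖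
  have hd : (0 : ℝ) < d := by exact_mod_cast NeZero.pos d
  refine ⟨‖μ i₀‖, norm_nonneg _, fun s hs => ?_, fun a ha0 ha => ?_⟩
  · let η := (s - ‖μ i₀‖) / d
    have hη : 0 < η := div_pos (sub_pos.2 hs) hd
    obtain ⟨Φ, hΦ, hM⟩ := hμ (η / 2) (half_pos hη)
    obtain ⟨δ, hδ, hB⟩ := exists_forall_norm_sub_lt_near_diagonal hη hM
    obtain ⟨C, hC, hCB⟩ := exists_norm_le_sum_norm_entry hΦ
    refine ⟨δ, hδ, C * d, by positivity, fun B hBM n => (hCB _).trans ?_⟩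
    have hs' : ‖μ i₀‖ + d * η = s := by
      simp only [η]
      field_simp
      ring
    have h (j : Fin d) : ∑ i, ‖Φ (B ^ n) i j‖ ≤ s ^ n := by
      have := sum_norm_pow_mulVec_le (hB B hBM) hi₀ (by positivity) (Pi.single j 1) n
      rw [hs', ← map_pow] at this
      simpa [Pi.single_apply, apply_ite] using this
    rw [mul_assoc]
    refine mul_le_mul_of_nonneg_left ?_ hC.le
    refine (Finset.sum_le_sum fun j _ => h j).trans_eq ?_
    simp
  -- Only finitely many moduli occur, so a small `η` fits `4 * (d * η)` below every gap to the
  -- maximum and keeps the expansion rate above `a`.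
  · have hev : ∀ᶠ η in 𝓝[>] (0 : ℝ), 0 < η ∧ 4 * (d * η) < ‖μ i₀‖ ∧
        2 * (d * η) < ‖μ i₀‖ - a ∧
        ∀ i, ‖μ i‖ ≠ ‖μ i₀‖ → 4 * (d * η) < ‖μ i₀‖ - ‖μ i‖ := by
      have ht (k : ℝ) {r : ℝ} (hr : 0 < r) : ∀ᶠ η in 𝓝[>] (0 : ℝ), k * (d * η) < r := by
        have : Tendsto (fun η : ℝ => k * (d * η)) (𝓝[>] 0) (𝓝 (k * (d * 0))) :=
          (Continuous.tendsto (by fun_prop) 0).mono_left nhdsWithin_le_nhds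
        rw [mul_zero, mul_zero] at this
        exact this.eventually_lt_const hr
      refine eventually_mem_nhdsWithin.and ((ht 4 (ha0.trans ha)).and ((ht 2 (sub_pos.2 ha)).and ?_))
      refine eventually_all.2 fun i => ?_
      by_cases hi : ‖μ i‖ = ‖μ i₀‖
      · simp [hi]
      · filter_upwards [ht 4 (sub_pos.2 (lt_of_le_of_ne (hi₀ i) hi))] with η h _ using h
    obtain ⟨η, hη, h4, h2, hgap⟩ := hev.exists
    obtain ⟨Φ, hΦ, hM⟩ := hμ (η / 2) (half_pos hη)
    obtain ⟨δ, hδ, hB⟩ := exists_forall_norm_sub_lt_near_diagonal hη hM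
    obtain ⟨C, hC, hCB⟩ := exists_norm_entry_le Φ
    refine ⟨δ, hδ, (d * C)⁻¹, by positivity, fun L hL => ?_⟩
    let s : Finset (Fin d) := Finset.univ.filter fun i => ‖μ i‖ = ‖μ i₀‖
    have hi₀s : i₀ ∈ s := by simp [s]
    have hcone := (cone_list_prod_mulVec (ρ := ‖μ i₀‖) (x := Pi.single i₀ 1) s hη.le
      (fun i hi => by simp [s] at hi; exact hi.ge)
      (fun i hi => by simp [s] at hi; linarith [hgap i hi]) (by linarith)
      (by simp [Pi.single_apply, apply_ite, hi₀s]) (L.map Φ) (by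
        intro T hT
        obtain ⟨B, hBL, rfl⟩ := List.mem_map.1 hT
        exact hB B (hL B hBL))).1
    rw [List.length_map, ← map_list_prod] at hcone
    have h1 : ∑ i ∈ s, ‖((Φ L.prod).mulVec (Pi.single i₀ 1)) i‖ ≤ d * C * ‖L.prod‖ := by
      calc _ ≤ ∑ i, ‖((Φ L.prod).mulVec (Pi.single i₀ 1)) i‖ :=
            Finset.sum_le_univ_sum_of_nonneg fun _ => norm_nonneg _
        _ ≤ ∑ _i : Fin d, C * ‖L.prod‖ := Finset.sum_le_sum fun i _ => by
            simpa using hCB L.prod i i₀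
        _ = _ := by simp [mul_assoc]
    have h5 : ∑ i ∈ s, ‖(Pi.single i₀ 1 : Fin d → ℂ) i‖ = 1 := by
      simp [Pi.single_apply, apply_ite, hi₀s]
    rw [h5, mul_one] at hcone
    rw [inv_mul_le_iff₀ (by positivity)]
    exact ((pow_le_pow_left₀ ha0.le (by linarith) _).trans hcone).trans h1

/-! ### Bounds on the lower spectral radius -/

lemma lowerSpectralRadius_nonneg {d : ℕ} (S : Set (Matrix (Fin d) (Fin d) ℝ)) :
    0 ≤ lowerSpectralRadius S :=
  Real.iInf_nonneg fun n => Real.sInf_nonneg (by rintro r ⟨L, -, -, rfl⟩; positivity)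

lemma lowerSpectralRadius_le {d : ℕ} {S : Set (Matrix (Fin d) (Fin d) ℝ)} {n : ℕ} (hn : 0 < n)
    (L : List (Matrix (Fin d) (Fin d) ℝ)) (hL : L.length = n) (hS : ∀ B ∈ L, B ∈ S) :
    lowerSpectralRadius S ≤ ‖L.prod‖ ^ (1 / (n : ℝ)) := by
  refine (ciInf_le ⟨0, ?_⟩ (⟨n, hn⟩ : ℕ+)).trans (csInf_le ⟨0, ?_⟩ ⟨L, hL, hS, rfl⟩)
  · rintro _ ⟨m, rfl⟩
    exact Real.sInf_nonneg (by rintro r ⟨L, -, -, rfl⟩; positivity)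
  · rintro r ⟨L, -, -, rfl⟩
    positivity

lemma lowerSpectralRadius_le_of_pow_le {d : ℕ} {S : Set (Matrix (Fin d) (Fin d) ℝ)}
    {B : Matrix (Fin d) (Fin d) ℝ} (hB : B ∈ S) {C s : ℝ} (hC : 0 < C) (hs : 0 ≤ s)
    (h : ∀ n : ℕ, ‖B ^ n‖ ≤ C * s ^ n) : lowerSpectralRadius S ≤ s := by
  refine le_of_forall_mul_pow_le (inv_pos.2 hC) hs fun k hk => ?_
  have h1 := lowerSpectralRadius_le hk (List.replicate k B) (by simp)
    (fun T hT => (List.eq_of_mem_replicate hT) ▸ hB)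
  rw [List.prod_replicate] at h1
  rw [inv_mul_le_iff₀ hC]
  refine le_trans ?_ (h k)
  calc _ ≤ (‖B ^ k‖ ^ (1 / (k : ℝ))) ^ k :=
        pow_le_pow_left₀ (lowerSpectralRadius_nonneg S) h1 k
    _ = ‖B ^ k‖ := by rw [one_div, Real.rpow_inv_natCast_pow (norm_nonneg _) hk.ne']

/-- Repeating a word `k` times pays the constant `c` only once, so submultiplicativity and `k → ∞`
remove it. -/
lemma le_lowerSpectralRadius {d : ℕ} {S : Set (Matrix (Fin d) (Fin d) ℝ)} (hS : S.Nonempty)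
    {c a : ℝ} (hc : 0 < c) (ha : 0 ≤ a)
    (h : ∀ L : List (Matrix (Fin d) (Fin d) ℝ), (∀ B ∈ L, B ∈ S) → c * a ^ L.length ≤ ‖L.prod‖) :
    a ≤ lowerSpectralRadius S := by
  obtain ⟨B₀, hB₀⟩ := hS
  refine le_ciInf fun n => le_csInf ?_ ?_
  · exact ⟨_, List.replicate n B₀, by simp, fun T hT => (List.eq_of_mem_replicate hT) ▸ hB₀, rfl⟩
  · rintro r ⟨L, hL, hLS, rfl⟩
    have hn : (n : ℕ) ≠ 0 := n.ne_zero
    rw [one_div, Real.le_rpow_inv_iff_of_pos ha (norm_nonneg _) (by exact_mod_cast n.pos),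
      Real.rpow_natCast]
    refine le_of_forall_mul_pow_le hc (norm_nonneg _) fun k hk => ?_
    have h1 := h (List.replicate k L).flatten (by
      intro B hB
      obtain ⟨l, hl, hBl⟩ := List.mem_flatten.1 hB
      rw [List.eq_of_mem_replicate hl] at hBl
      exact hLS B hBl)
    rw [List.prod_flatten, List.map_replicate, List.prod_replicate, List.length_flatten,
      List.map_replicate, List.sum_replicate, hL, smul_eq_mul, mul_comm k, pow_mul] at h1
    exact h1.trans (norm_pow_le' _ hk)

lemma CompactsGL.norm_sub_lt_of_dist_lt {d : ℕ} {A K : CompactsGL d}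
    {M : Matrix (Fin d) (Fin d) ℝ} (hA : A.toSet = {M}) {δ : ℝ} (h : dist K A < δ)
    {B : Matrix (Fin d) (Fin d) ℝ} (hB : B ∈ K.toSet) : ‖B - M‖ < δ := by
  rw [CompactsGL.dist_eq] at h
  obtain ⟨y, hy, hBy⟩ := Metric.exists_dist_lt_of_hausdorffDist_lt hB h
    (Metric.hausdorffEDist_ne_top_of_nonempty_of_bounded K.1.nonempty A.1.nonempty
      K.1.isCompact.isBounded A.1.isCompact.isBounded)
  rw [hA, Set.mem_singleton_iff] at hy
  rwa [hy, dist_eq_norm] at hBy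

theorem mainTheorem8 (d : ℕ) (A : CompactsGL d) (M : Matrix (Fin d) (Fin d) ℝ)
    (hA : A.toSet = {M}) :
    ContinuousAt (fun K : CompactsGL d => lowerSpectralRadius K.toSet) A := by
  rcases Nat.eq_zero_or_pos d with rfl | hd
  -- There is only one `0 × 0` matrix, so the function is constant; a maximal eigenvalue needs `d >
  -- 0`.
  · have h (K L : CompactsGL 0) : K.toSet = L.toSet :=
      Set.Nonempty.eq_univ K.1.nonempty |>.trans (Set.Nonempty.eq_univ L.1.nonempty).symm
    simp only [fun K => h K A]
    exact continuousAt_const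
  have : NeZero d := ⟨hd.ne'⟩
  obtain ⟨ρ, hρ, hup, hlow⟩ := exists_growth_rate M
  have hle {s : ℝ} (hs : ρ < s) :
      ∀ᶠ K in nhds A, lowerSpectralRadius (CompactsGL.toSet K) ≤ s := by
    obtain ⟨δ, hδ, C, hC, h⟩ := hup s hs
    filter_upwards [Metric.ball_mem_nhds A hδ] with K hK
    obtain ⟨B, hB⟩ := K.1.nonempty
    exact lowerSpectralRadius_le_of_pow_le hB hC (hρ.trans hs.le)
      (h B (CompactsGL.norm_sub_lt_of_dist_lt hA hK hB))
  have hge {a : ℝ} (ha : a < ρ) :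
      ∀ᶠ K in nhds A, a ≤ lowerSpectralRadius (CompactsGL.toSet K) := by
    rcases le_or_gt a 0 with ha0 | ha0
    · exact Filter.Eventually.of_forall fun K => ha0.trans (lowerSpectralRadius_nonneg _)
    obtain ⟨δ, hδ, c, hc, h⟩ := hlow a ha0 ha
    filter_upwards [Metric.ball_mem_nhds A hδ] with K hK
    exact le_lowerSpectralRadius K.1.nonempty hc ha0.le fun L hL =>
      h L fun B hB => CompactsGL.norm_sub_lt_of_dist_lt hA hK (hL B hB)
  -- The neighbourhood bounds hold at `A` itself, which identifies the value there.
  have hval : lowerSpectralRadius A.toSet = ρ :=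
    le_antisymm (le_of_forall_gt_imp_ge_of_dense fun s hs => (hle hs).self_of_nhds)
      (le_of_forall_lt_imp_le_of_dense fun a ha => (hge ha).self_of_nhds)
  rw [ContinuousAt, hval]
  refine tendsto_order.2 ⟨fun a ha => ?_, fun s hs => ?_⟩
  · obtain ⟨b, hab, hb⟩ := exists_between ha
    exact (hge hb).mono fun K hK => hab.trans_le hK
  · obtain ⟨b, hb, hbs⟩ := exists_between hs
    exact (hle hb).mono fun K hK => hK.trans_lt hbs
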